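/- Let $F$ be a field and let $n$, $a$, $d$ be positive integers. Put $S=F[x_1,\dots,x_n]$ and $R=F[x_1,\dots,x_n]/(x_1^a)$ with the standard grading, and order monomials lexicographically with $x_1>\dots>x_n$. Monomials of $R$ are the monomials of $S$ that are non-zero in $R$, and a set $M$ of monomials of degree $t$ in $R$ (or in $S$) is called lexsegment if $m\in M$ and $v>m$ imply $v\in M$ for all monomials $v$ of $R_t$ (of $S_t$, respectively). Write $S_1\cdot M$ for the set of all products of a variable and a monomial of $M$, and $R_1\cdot M$ for the set of those monomials in $S_1\cdot M$ that are non-zero in $R$. If $R_t$ contains at least $d$ monomials, let $d_{n,t}$ denote the size of $R_1\cdot L$, where $L$ is the lexsegment set of size $d$ in $R_t$; otherwise $d_{n,t}$ is undefined. For $n\ge 3$ let $d^{<n-2>}$ denote the size of $S'_1\cdot L'$, where $S'$ is the polynomial ring over $F$ in $n-1$ variables and $L'$ is a lexsegment set of $d$ monomials of the same degree $s$ in $S'$; this number does not depend on the choice of $s$, as is part of the claim. With $a$ and $d$ fixed, the following hold. 1. For every $t\ge 1$ for which $d_{n,t}$ is defined, $d_{n+1,t}$ is defined and $d_{n+1,t}>d_{n,t}$.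 2. For every $t\ge 1$ for which $d_{n,t}$ and $d_{n,t+1}$ are defined, $d_{n,t+1}\le d_{n,t}$. 3. If $n\ge 3$, then for all sufficiently large $t'$ the number $d_{n,t'}$ is defined and $d_{n,t'}=d^{<n-2>}$. -/

import Mathlib

open MvPolynomial

noncomputable section

/-- The monomial `x_1 ^ e_1 ⋯ x_n ^ e_n` is represented by its exponent vector `e`; the variable
`x_{i+1}` is the one with index `i : Fin n`. -/
abbrev Mon (n : ℕ) : Type := Fin n →₀ ℕ

/-- The ideal `(x_1 ^ a)` of `S = F[x_1, …, x_n]`. (There is exactly one index `i : Fin n` with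
value `0` as soon as `n` is positive.) -/
def purePowerIdeal (F : Type*) [Field F] (n a : ℕ) : Ideal (MvPolynomial (Fin n) F) :=
  Ideal.span {p | ∃ i : Fin n, (i : ℕ) = 0 ∧ p = X i ^ a}

/-- The quotient ring `R = F[x_1, …, x_n] / (x_1 ^ a)`. -/
abbrev QuotRing (F : Type*) [Field F] (n a : ℕ) : Type _ :=
  MvPolynomial (Fin n) F ⧸ purePowerIdeal F n a

/-- The image of a monomial of `S` in `R` is not zero. -/
def NonzeroInR (F : Type*) [Field F] (n a : ℕ) (e : Mon n) : Prop :=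
  (Ideal.Quotient.mk (purePowerIdeal F n a) (monomial e (1 : F)) : QuotRing F n a) ≠ 0

/-- The monomials in `S_t`. -/
def monS (n t : ℕ) : Set (Mon n) := {e | e.degree = t}

/-- The monomials in `R_t`, regarded as monomials of `S`. -/
def monR (F : Type*) [Field F] (n a t : ℕ) : Set (Mon n) :=
  {e | e ∈ monS n t ∧ NonzeroInR F n a e}

/-- `S_1 · M`: all products of a variable and a monomial in `M`. -/
def mulS {n : ℕ} (M : Set (Mon n)) : Set (Mon n) :=
  {e | ∃ i : Fin n, ∃ m ∈ M, e = Finsupp.single i 1 + m}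

/-- `R_1 · M`: the monomials in `S_1 · M` that are not zero in `R`. -/
def mulR (F : Type*) [Field F] {n : ℕ} (a : ℕ) (M : Set (Mon n)) : Set (Mon n) :=
  {e | e ∈ mulS M ∧ NonzeroInR F n a e}

/-- `M` is a lexsegment set inside the set `A` of all monomials of a fixed degree (of `S` or of
`R`), for the lexicographic order with `x_1 > ⋯ > x_n`. -/
def IsLexsegment {n : ℕ} (A M : Set (Mon n)) : Prop :=
  M ⊆ A ∧ ∀ m ∈ M, ∀ v ∈ A, toLex m < toLex v → v ∈ M

/-- The lexsegment set of size `d` in `A`, that is, the `d` largest monomials of `A`; see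
`isLexsegment_lexSet`, `ncard_lexSet` and `eq_lexSet`. -/
def lexSet {n : ℕ} (A : Set (Mon n)) (d : ℕ) : Set (Mon n) :=
  {m | m ∈ A ∧ {v | v ∈ A ∧ toLex m < toLex v}.ncard < d}

/-- `d_{n,t}`: the size of `R_1 · L` for the lexsegment set `L` of size `d` in `R_t`. It is
meaningful when `R_t` has at least `d` monomials. -/
def growthR (F : Type*) [Field F] (n a t d : ℕ) : ℕ :=
  (mulR F a (lexSet (monR F n a t) d)).ncard

/-- The size of `S_1 · L` for the lexsegment set `L` of size `d` in `S_t`, where `S` has `n`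
variables. It is meaningful when `S_t` has at least `d` monomials. -/
def growthS (n t d : ℕ) : ℕ :=
  (mulS (lexSet (monS n t) d)).ncard

theorem monS_finite (n t : ℕ) : (monS n t).Finite :=
  Finsupp.finite_of_degree_eq t

theorem monR_finite (F : Type*) [Field F] (n a t : ℕ) : (monR F n a t).Finite :=
  (monS_finite n t).subset fun _ h => h.1

theorem isLexsegment_lexSet {n : ℕ} {A : Set (Mon n)} (hA : A.Finite) (d : ℕ) :
    IsLexsegment A (lexSet A d) := by
  refine ⟨fun _ h => h.1, fun m hm v hv hlt => ⟨hv, lt_of_le_of_lt ?_ hm.2⟩⟩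
  exact Set.ncard_le_ncard (fun w hw => ⟨hw.1, hlt.trans hw.2⟩) (hA.subset fun _ h => h.1)

/-- Any lexsegment set is the one of its size. -/
theorem eq_lexSet {n : ℕ} {A M : Set (Mon n)} (hA : A.Finite) (hM : IsLexsegment A M) :
    M = lexSet A M.ncard := by
  have hMf := hA.subset hM.1
  ext m
  constructor
  · intro hm
    refine ⟨hM.1 hm, Set.ncard_lt_ncard ⟨fun v hv => hM.2 m hm v hv.1 hv.2, ?_⟩ hMf⟩
    exact fun h => lt_irrefl _ (h hm).2
  · rintro ⟨hmA, hlt⟩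
    by_contra hm
    refine absurd hlt (not_lt.mpr (Set.ncard_le_ncard ?_ (hA.subset fun _ h => h.1)))
    intro v hv
    refine ⟨hM.1 hv, ?_⟩
    by_contra hle
    rcases (not_lt.mp hle).lt_or_eq with h | h
    · exact hm (hM.2 v hv m hmA h)
    · exact hm (toLex.injective h ▸ hv)

/-- A lexsegment set of every possible size exists. -/
theorem exists_isLexsegment {n : ℕ} {A : Set (Mon n)} (hA : A.Finite) {d : ℕ}
    (hd : d ≤ A.ncard) : ∃ M, IsLexsegment A M ∧ M.ncard = d := by
  induction d with
  | zero => exact ⟨∅, ⟨Set.empty_subset _, fun _ h => h.elim⟩, Set.ncard_empty _⟩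
  | succ d ih =>
    obtain ⟨M, hM, hc⟩ := ih (by omega)
    have hMf := hA.subset hM.1
    have hne : (A \ M).Nonempty := by
      by_contra h
      have := Set.ncard_le_ncard (Set.sdiff_eq_empty.mp (Set.not_nonempty_iff_eq_empty.mp h)) hMf
      omega
    obtain ⟨m, hm, hmax⟩ := Set.exists_max_image (A \ M) (fun v => toLex v) hA.sdiff hne
    refine ⟨insert m M, ⟨Set.insert_subset hm.1 hM.1, ?_⟩, ?_⟩
    · rintro w (rfl | hw) v hv hlt
      · by_contra h
        exact absurd hlt (not_lt.mpr (hmax v ⟨hv, fun h' => h (Or.inr h')⟩))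
      · exact Or.inr (hM.2 w hw v hv hlt)
    · rw [Set.ncard_insert_of_notMem hm.2 hMf, hc]

theorem ncard_lexSet {n : ℕ} {A : Set (Mon n)} (hA : A.Finite) {d : ℕ} (hd : d ≤ A.ncard) :
    (lexSet A d).ncard = d := by
  obtain ⟨M, hM, rfl⟩ := exists_isLexsegment hA hd
  rw [← eq_lexSet hA hM]

end

/-! When a lexsegment set is multiplied by the variables, a monomial with last variable `x_i`
contributes exactly its products with `x_j`, `j ≥ i`, as new monomials. So growth in `S` is an
initial sum of the list `weights`. For `t ≥ a`, sorting the monomials of `R_t` by the exponent of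
`x_1` makes growth in `R` an initial sum of `blocks`: weight lists in the remaining variables, in
`a` consecutive degrees (`growth_add`). For `t < a`, `R` and `S` differ only by the loss of `x_1 ^
a` (`growth_add_eq_growthS`).

The core is that these lists are `SegmentBalanced` (`balanced_weights`, `balanced_blocks`). Claims 1
and 2 then reduce to finding the list with the smaller sum as a non-initial segment of a list whose
initial entries are those of the other; for claim 1 with `t ≥ a` the other list is a concatenation
of such initial pieces (`prefixSum_weights_add_le_blocks`). Claim 3 holds because weight lists in
different degrees extend one another and the first block eventually has `d` entries. -/

/-! ### Initial sums of lists -/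

/-- The sum of the first `k` entries. -/
def prefixSum (L : List ℕ) (k : ℕ) : ℕ := (L.take k).sum

theorem prefixSum_zero (L : List ℕ) : prefixSum L 0 = 0 := by simp [prefixSum]

theorem prefixSum_append (L B : List ℕ) (k : ℕ) :
    prefixSum (L ++ B) k = prefixSum L k + prefixSum B (k - L.length) := by
  simp [prefixSum, List.take_append]

theorem prefixSum_of_length_le {L : List ℕ} {k : ℕ} (h : L.length ≤ k) :
    prefixSum L k = prefixSum L L.length := by
  simp [prefixSum, List.take_of_length_le h]

theorem prefixSum_append_left {L : List ℕ} (B : List ℕ) {k : ℕ} (h : k ≤ L.length) :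
    prefixSum (L ++ B) k = prefixSum L k := by
  rw [prefixSum_append, Nat.sub_eq_zero_of_le h, prefixSum_zero, add_zero]

theorem prefixSum_append_right (L B : List ℕ) (k : ℕ) :
    prefixSum (L ++ B) (L.length + k) = prefixSum L L.length + prefixSum B k := by
  rw [prefixSum_append, prefixSum_of_length_le (Nat.le_add_right _ _), Nat.add_sub_cancel_left]

theorem prefixSum_of_prefix {L B : List ℕ} (h : L <+: B) {k : ℕ} (hk : k ≤ L.length) :
    prefixSum B k = prefixSum L k := by
  obtain ⟨C, rfl⟩ := h
  exact prefixSum_append_left C hk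

/-! ### Balanced lists and domination -/

/-- Among the segments of a given length, the initial one has the largest sum and the final one
has the smallest sum. -/
def SegmentBalanced (L : List ℕ) : Prop :=
  ∀ x y, x ≤ L.length → y ≤ L.length →
    (x + y ≤ L.length → prefixSum L (x + y) ≤ prefixSum L x + prefixSum L y) ∧
    (L.length ≤ x + y → prefixSum L L.length + prefixSum L (x + y - L.length) ≤
      prefixSum L x + prefixSum L y)

/-- Initial and final segments of `L` have at least the sums of those of `B`. -/
def Dominates (L B : List ℕ) : Prop :=
  ∀ k, k ≤ L.length → k ≤ B.length →
    prefixSum B k ≤ prefixSum L k ∧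
    prefixSum B B.length + prefixSum L (L.length - k) ≤
      prefixSum L L.length + prefixSum B (B.length - k)

theorem balanced_nil : SegmentBalanced [] := by
  intro x y hx hy
  simp [prefixSum]

theorem balanced_singleton (c : ℕ) : SegmentBalanced [c] := by
  intro x y hx hy
  simp only [List.length_singleton] at hx hy
  interval_cases x <;> interval_cases y <;> simp [prefixSum]

theorem dominates_nil (B : List ℕ) : Dominates [] B := by
  intro k hk _
  obtain rfl : k = 0 := by simpa using hk
  simp [prefixSum]

theorem SegmentBalanced.append {L B : List ℕ} (hL : SegmentBalanced L) (hB : SegmentBalanced B)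
    (h : Dominates L B) : SegmentBalanced (L ++ B) := by
  -- Both inequalities are symmetric in `x` and `y`: a segment of length `y` starting at `x` may be
  -- traded for one of length `x` starting at `y`.
  have key : ∀ x y, x ≤ y → x ≤ (L ++ B).length → y ≤ (L ++ B).length →
      (x + y ≤ (L ++ B).length →
        prefixSum (L ++ B) (x + y) ≤ prefixSum (L ++ B) x + prefixSum (L ++ B) y) ∧
      ((L ++ B).length ≤ x + y →
        prefixSum (L ++ B) (L ++ B).length + prefixSum (L ++ B) (x + y - (L ++ B).length) ≤
        prefixSum (L ++ B) x + prefixSum (L ++ B) y) := by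
    intro x y hxy hx hy
    rw [List.length_append] at *
    rw [prefixSum_append_right]
    have hleft : ∀ k, k ≤ L.length → prefixSum (L ++ B) k = prefixSum L k :=
      fun k hk => prefixSum_append_left B hk
    have hright : ∀ k, prefixSum (L ++ B) (L.length + k) = prefixSum L L.length + prefixSum B k :=
      prefixSum_append_right L B
    -- every segment of `L` has at least the sum of the final segment of `B` of its length
    have hseg : ∀ z k, k ≤ z → z ≤ L.length → k ≤ B.length →
        prefixSum B B.length + prefixSum L (z - k) ≤ prefixSum L z + prefixSum B (B.length - k) := by
      intro z k hkz hzM hkN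
      have h1 := (h k (by omega) hkN).2
      have h2 := (hL z (L.length - k) hzM (by omega)).2 (by omega)
      rw [show z + (L.length - k) - L.length = z - k by omega] at h2
      omega
    constructor
    · intro hle
      rcases le_or_gt y L.length with hyM | hyM
      · rw [hleft x (by omega), hleft y hyM]
        rcases le_or_gt (x + y) L.length with h1 | h1
        · rw [hleft _ h1]
          exact (hL x y (by omega) hyM).1 h1
        -- The segment straddles the junction: domination replaces its part in `B` by an initial
        -- segment of `L`, and the final-segment inequality for `L` concludes.
        · have h2 := (hL x y (by omega) hyM).2 (by omega)
          have h3 := (h (x + y - L.length) (by omega) (by omega)).1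
          have h4 := hright (x + y - L.length)
          rw [show L.length + (x + y - L.length) = x + y by omega] at h4
          omega
      · obtain ⟨y', rfl⟩ := Nat.exists_eq_add_of_le hyM.le
        rcases le_or_gt x L.length with hxM | hxM
        · have h1 := (hB x y' (by omega) (by omega)).1 (by omega)
          have h2 := (h x (by omega) (by omega)).1
          rw [hleft x hxM, show x + (L.length + y') = L.length + (x + y') by omega, hright, hright]
          omega
        · obtain ⟨x', rfl⟩ := Nat.exists_eq_add_of_le hxM.le
          rw [show L.length + x' + (L.length + y') = L.length + (L.length + (x' + y')) by omega, hright, hright, hright]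
          have h1 := (hB L.length (x' + y') (by omega) (by omega)).1 (by omega)
          have h2 := (hB x' y' (by omega) (by omega)).1 (by omega)
          have h3 := (h L.length (by omega) (by omega)).1
          omega
    · intro hle
      rcases le_or_gt y L.length with hyM | hyM
      · have h1 := (hL x y (by omega) hyM).2 (by omega)
        have h2 := hseg (x + y - L.length) B.length (by omega) (by omega) le_rfl
        rw [Nat.sub_self, prefixSum_zero] at h2
        rw [hleft x (by omega), hleft y hyM, hleft _ (by omega),
          show x + y - (L.length + B.length) = x + y - L.length - B.length by omega]
        omega
      · obtain ⟨y', rfl⟩ := Nat.exists_eq_add_of_le hyM.le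
        rcases le_or_gt x L.length with hxM | hxM
        · have h1 := hseg x (B.length - y') (by omega) hxM (by omega)
          rw [show B.length - (B.length - y') = y' by omega] at h1
          rw [hleft x hxM, hright, hleft _ (by omega),
            show x + (L.length + y') - (L.length + B.length) = x - (B.length - y') by omega]
          omega
        · obtain ⟨x', rfl⟩ := Nat.exists_eq_add_of_le hxM.le
          rw [hright, hright]
          rcases le_or_gt B.length (x' + y') with h0 | h0
          · have h1 := (hB x' y' (by omega) (by omega)).2 (by omega)
            rw [show L.length + x' + (L.length + y') - (L.length + B.length) = L.length + (x' + y' - B.length) by omega, hright]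
            omega
          · have h1 := (hB x' y' (by omega) (by omega)).1 (by omega)
            have h2 := (h (B.length - (x' + y')) (by omega) (by omega)).2
            rw [show B.length - (B.length - (x' + y')) = x' + y' by omega] at h2
            rw [hleft _ (by omega),
              show L.length + x' + (L.length + y') - (L.length + B.length) = L.length - (B.length - (x' + y')) by omega]
            omega
  intro x y hx hy
  rcases le_total x y with hxy | hxy
  · exact key x y hxy hx hy
  · rw [add_comm x y, add_comm (prefixSum _ x)]
    exact key y x hxy hy hx

/-- A segment of `C` longer than `L` (initial case) or `B` (final case) is cut in two: one piece is
dominated by `L`, the other is at most the initial segment of `C` of its length, which lies in `B`.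
A final segment inside `B` is a segment of `C`, hence at least the final one of `C`. -/
theorem Dominates.append {L B C : List ℕ} (h : Dominates L C) (hBC : B <+: C)
    (hC : SegmentBalanced C) : Dominates (L ++ B) C := by
  intro k hk hkC
  have hlen := hBC.length_le
  have hpre : ∀ r, r ≤ B.length → prefixSum C r = prefixSum B r :=
    fun r hr => prefixSum_of_prefix hBC hr
  rw [List.length_append] at *
  rw [prefixSum_append_right]
  have hright : ∀ k, prefixSum (L ++ B) (L.length + k) = prefixSum L L.length + prefixSum B k :=
    prefixSum_append_right L B
  constructor
  · rcases le_or_gt k L.length with hkM | hkM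
    · rw [prefixSum_append_left B hkM]
      exact (h k hkM hkC).1
    · obtain ⟨r, rfl⟩ := Nat.exists_eq_add_of_le hkM.le
      rw [hright]
      have h1 := (hC L.length r (by omega) (by omega)).1 (by omega)
      have h2 := (h L.length le_rfl (by omega)).1
      have h3 := hpre r (by omega)
      omega
  · rcases le_or_gt k B.length with hkN | hkN
    · have h1 := (hC B.length (C.length - k) (by omega) (by omega)).2 (by omega)
      rw [show B.length + (C.length - k) - C.length = B.length - k by omega, hpre B.length le_rfl, hpre (B.length - k) (by omega)] at h1
      rw [show L.length + B.length - k = L.length + (B.length - k) by omega, hright]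
      omega
    · obtain ⟨j, rfl⟩ := Nat.exists_eq_add_of_le hkN.le
      have h1 := (h j (by omega) (by omega)).2
      have h2 := (hC B.length (C.length - (B.length + j)) (by omega) (by omega)).1 (by omega)
      rw [show B.length + (C.length - (B.length + j)) = C.length - j by omega, hpre B.length le_rfl] at h2
      rw [show L.length + B.length - (B.length + j) = L.length - j by omega, prefixSum_append_left B (by omega)]
      omega

/-! ### Weight lists and their concatenations -/

/-- The numbers `m + 1 - i` for the monomials of degree `s` in `x_0, …, x_m`, taken in
lexicographic order, where `x_i` is the last variable that divides the monomial. -/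
def weights : ℕ → ℕ → List ℕ
  | 0, _ => [1]
  | m + 1, 0 => [m + 2]
  | m + 1, s + 1 => weights (m + 1) s ++ weights m (s + 1)

/-- The concatenation of `weights m p, …, weights m (p + a - 1)`. -/
def blocks (m p : ℕ) : ℕ → List ℕ
  | 0 => []
  | a + 1 => blocks m p a ++ weights m (p + a)

/-- The monomial `1` has no last variable; all `m + 1` variables count for it. -/
theorem weights_degree_zero (m : ℕ) : weights m 0 = [m + 1] := by
  cases m <;> simp [weights]

theorem weights_prefix (m : ℕ) {s t : ℕ} (h : s ≤ t) : weights m s <+: weights m t := by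
  cases m with
  | zero => simp [weights]
  | succ m =>
    induction h with
    | refl => exact List.prefix_rfl
    | step _ ih =>
      rw [weights]
      exact ih.trans (List.prefix_append _ _)

theorem blocks_succ' (m p a : ℕ) : blocks m p (a + 1) = weights m p ++ blocks m (p + 1) a := by
  induction a with
  | zero => simp [blocks]
  | succ a ih =>
    rw [blocks, ih, blocks, List.append_assoc, show p + 1 + a = p + (a + 1) by omega]

theorem weights_succ_add (m p a : ℕ) :
    weights (m + 1) (p + a) = weights (m + 1) p ++ blocks m (p + 1) a := by
  induction a with
  | zero => simp [blocks]
  | succ a ih =>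
    rw [← add_assoc, weights, ih, blocks, List.append_assoc, show p + 1 + a = p + a + 1 by omega]

theorem length_weights_pos (m s : ℕ) : 0 < (weights m s).length := by
  have := (weights_prefix m (Nat.zero_le s)).length_le
  simp only [weights_degree_zero, List.length_singleton] at this
  omega

theorem length_weights_le_succ (m s : ℕ) :
    (weights m s).length ≤ (weights (m + 1) s).length := by
  cases s with
  | zero => simp [weights_degree_zero]
  | succ s => simp [weights]

/-- With at least two variables the lists become arbitrarily long; this is where `n ≥ 3` enters
claim 3. -/
theorem lt_length_weights (m s : ℕ) : s < (weights (m + 1) s).length := by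
  induction s with
  | zero => exact length_weights_pos _ _
  | succ s ih =>
    have := length_weights_pos m (s + 1)
    rw [weights, List.length_append]
    omega

theorem length_blocks_le_succ (m p a : ℕ) :
    (blocks m p a).length ≤ (blocks (m + 1) p a).length := by
  induction a with
  | zero => simp [blocks]
  | succ a ih =>
    have := length_weights_le_succ m (p + a)
    simp only [blocks, List.length_append]
    omega

theorem dominates_blocks {m : ℕ} (hm : ∀ s, SegmentBalanced (weights m s)) (p a : ℕ) {s : ℕ}
    (hs : p + a ≤ s + 1) : Dominates (blocks m p a) (weights m s) := by
  induction a with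
  | zero => exact dominates_nil _
  | succ a ih => exact (ih (by omega)).append (weights_prefix m (by omega)) (hm s)

theorem balanced_blocks {m : ℕ} (hm : ∀ s, SegmentBalanced (weights m s)) (p a : ℕ) :
    SegmentBalanced (blocks m p a) := by
  induction a with
  | zero => exact balanced_nil
  | succ a ih => exact ih.append (hm _) (dominates_blocks hm p a (by omega))

theorem length_weights_succ (m s : ℕ) :
    (weights (m + 1) s).length = (blocks m 0 (s + 1)).length := by
  rw [blocks_succ', ← zero_add s, weights_succ_add, List.length_append, List.length_append,
    weights_degree_zero, weights_degree_zero]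
  simp

/-- Both lists continue with `blocks m 1 s`; only the first entries, `m + 2` and `m + 1`, differ.
This extra unit is the source of all strict inequalities. -/
theorem prefixSum_weights_succ (m s k : ℕ) :
    prefixSum (weights (m + 1) s) k = prefixSum (blocks m 0 (s + 1)) k + min k 1 := by
  rw [blocks_succ', ← zero_add s, weights_succ_add, prefixSum_append, prefixSum_append,
    weights_degree_zero, weights_degree_zero]
  cases k with
  | zero => simp [prefixSum]
  | succ k => simp [prefixSum]; omega

theorem balanced_weights (m s : ℕ) : SegmentBalanced (weights m s) := by
  induction m generalizing s with
  | zero => simpa only [weights] using balanced_singleton 1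
  | succ m ih =>
    have hb := balanced_blocks ih 0 (s + 1)
    -- Needed when `x + y` is the full length: one of `x`, `y` is then positive and pays for the
    -- raised first entry.
    have hpos := length_weights_pos (m + 1) s
    intro x y hx hy
    simp only [prefixSum_weights_succ]
    rw [length_weights_succ] at *
    obtain ⟨h1, h2⟩ := hb x y hx hy
    constructor
    · intro h
      have := h1 h
      omega
    · intro h
      have := h2 h
      omega

/-! ### Comparisons of initial sums -/

theorem prefixSum_weights_add_lt {m s x y : ℕ} (hx : 0 < x) (hy : 0 < y)
    (h : x + y ≤ (weights m s).length) :
    prefixSum (weights m s) (x + y) < prefixSum (weights m s) x + prefixSum (weights m s) y := by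
  cases m with
  | zero =>
    simp only [weights, List.length_singleton] at h
    omega
  | succ m =>
    have hb := balanced_blocks (balanced_weights m) 0 (s + 1)
    simp only [prefixSum_weights_succ]
    rw [length_weights_succ] at h
    have := (hb x y (by omega) (by omega)).1 h
    omega

/-- A segment of `weights m s` that is not initial has a smaller sum than as many entries of a
concatenation of initial segments. -/
theorem prefixSum_weights_add_le_blocks {m s p a z d : ℕ} (hs : p + a ≤ s + 1) (hz : 0 < z)
    (hd : d ≤ (blocks m p a).length) (h : z + d ≤ (weights m s).length) :
    prefixSum (weights m s) (z + d) + min d 1 ≤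
      prefixSum (weights m s) z + prefixSum (blocks m p a) d := by
  induction a generalizing d with
  | zero =>
    obtain rfl : d = 0 := by simpa [blocks] using hd
    simp
  | succ a ih =>
    rw [blocks]
    rcases le_or_gt d (blocks m p a).length with hle | hgt
    · rw [prefixSum_append_left _ hle]
      exact ih (by omega) hle h
    · obtain ⟨r, rfl⟩ := Nat.exists_eq_add_of_le hgt.le
      rw [blocks, List.length_append] at hd
      rw [prefixSum_append_right, ← prefixSum_of_prefix
        (weights_prefix m (show p + a ≤ s by omega)) (by omega : r ≤ (weights m (p + a)).length)]
      -- The earlier blocks may be empty, and then `h1` has no slack; the strict `h2` for the last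
      -- `r` entries supplies the unit.
      have h1 := ih (by omega) le_rfl (by omega)
      have h2 := prefixSum_weights_add_lt (m := m) (s := s)
        (x := z + (blocks m p a).length) (y := r) (by omega) (by omega) (by omega)
      rw [← add_assoc]
      omega

/-- For `s > 0`, `weights m s` is what follows `weights (m + 1) (s - 1)` in `weights (m + 1) s`. -/
theorem prefixSum_weights_lt_succ {m s d : ℕ} (hs : 0 < s) (hd : 0 < d)
    (h : d ≤ (weights m s).length) :
    prefixSum (weights m s) d < prefixSum (weights (m + 1) s) d := by
  obtain ⟨s, rfl⟩ : ∃ r, s = r + 1 := ⟨s - 1, by omega⟩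
  have h1 := prefixSum_weights_add_lt (m := m + 1) (s := s + 1) (length_weights_pos (m + 1) s) hd
    (by rw [weights, List.length_append]; omega)
  have h2 := prefixSum_of_prefix (weights_prefix (m + 1) s.le_succ) le_rfl
  nth_rw 1 [weights] at h1
  rw [prefixSum_append_right] at h1
  simp only [Nat.succ_eq_add_one] at h2
  omega

/-- `blocks m (p + 1) a` is the final part of `weights (m + 1) (p + a)`, and every piece of `blocks
(m + 1) (p + 1) a` is a prefix of that same list. -/
theorem prefixSum_blocks_lt_succ {m p a d : ℕ} (hd : 0 < d) (h : d ≤ (blocks m (p + 1) a).length) :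
    prefixSum (blocks m (p + 1) a) d < prefixSum (blocks (m + 1) (p + 1) a) d := by
  have h1 := prefixSum_weights_add_le_blocks (m := m + 1) (s := p + a) (p := p + 1) (a := a)
    (by omega) (length_weights_pos (m + 1) p) (h.trans (length_blocks_le_succ _ _ _))
    (by rw [weights_succ_add, List.length_append]; omega)
  have h2 := prefixSum_of_prefix (weights_prefix (m + 1) (p.le_add_right a)) le_rfl
  nth_rw 1 [weights_succ_add] at h1
  rw [prefixSum_append_right] at h1
  omega

/-- The balanced list `blocks m p (a + 1)` begins with `blocks m p a` and ends with `blocks m (p +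
1) a`. -/
theorem prefixSum_blocks_succ_le {m p a d : ℕ} (h : d ≤ (blocks m p a).length)
    (h' : d ≤ (blocks m (p + 1) a).length) :
    prefixSum (blocks m (p + 1) a) d ≤ prefixSum (blocks m p a) d := by
  have hl := congrArg List.length (blocks_succ' m p a)
  rw [List.length_append] at hl
  have h1 := (balanced_blocks (balanced_weights m) p (a + 1) (weights m p).length d (by omega)
    (by omega)).1 (by omega)
  nth_rw 1 2 [blocks_succ'] at h1
  rw [prefixSum_append_right, prefixSum_append_left _ le_rfl, blocks, prefixSum_append_left _ h]
    at h1
  omega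

theorem prefixSum_blocks_one_lt {m a d : ℕ} (hd : 0 < d) (h : d ≤ (blocks m 1 a).length) :
    prefixSum (blocks m 1 a) d < prefixSum (weights (m + 1) a) d := by
  have he := weights_succ_add m 0 a
  rw [zero_add, zero_add] at he
  have h1 := prefixSum_weights_add_lt (m := m + 1) (s := a) (length_weights_pos (m + 1) 0) hd
    (by rw [he, List.length_append]; omega)
  have h2 := prefixSum_of_prefix (weights_prefix (m + 1) a.zero_le) le_rfl
  nth_rw 1 [he] at h1
  rw [prefixSum_append_right] at h1
  omega

/-! ### Monomials of `R` and lexsegment sets -/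

theorem nonzeroInR_iff (F : Type*) [Field F] (n a : ℕ) (e : Mon (n + 1)) :
    NonzeroInR F (n + 1) a e ↔ e 0 < a := by
  have hspan : purePowerIdeal F (n + 1) a =
      Ideal.span ((fun s => monomial s (1 : F)) '' {Finsupp.single 0 a}) := by
    rw [purePowerIdeal, Set.image_singleton]
    congr 1
    ext p
    simp only [Set.mem_ofPred_eq, Set.mem_singleton_iff, X_pow_eq_monomial]
    constructor
    · rintro ⟨i, hi, rfl⟩
      rw [show i = 0 from Fin.ext hi]
    · rintro rfl
      exact ⟨0, rfl, rfl⟩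
  rw [NonzeroInR, Ne, Ideal.Quotient.eq_zero_iff_mem, hspan, mem_ideal_span_monomial_image]
  simp

/-- The monomials of degree `t` in which the exponent of the first variable is less than `a`. -/
def boundedMon (n a t : ℕ) : Set (Mon (n + 1)) := {e | e.degree = t ∧ e 0 < a}

/-- The products of a variable and a monomial in `M` in which the exponent of the first variable
is less than `a`. -/
def boundedMul {n : ℕ} (a : ℕ) (M : Set (Mon (n + 1))) : Set (Mon (n + 1)) :=
  {e | e ∈ mulS M ∧ e 0 < a}

theorem monR_eq (F : Type*) [Field F] (n a t : ℕ) : monR F (n + 1) a t = boundedMon n a t := by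
  ext e
  simp [monR, boundedMon, monS, nonzeroInR_iff]

theorem mulR_eq (F : Type*) [Field F] {n : ℕ} (a : ℕ) (M : Set (Mon (n + 1))) :
    mulR F a M = boundedMul a M := by
  ext e
  simp [mulR, boundedMul, nonzeroInR_iff]

theorem boundedMon_finite (n a t : ℕ) : (boundedMon n a t).Finite :=
  (monS_finite (n + 1) t).subset fun _ h => h.1

theorem lexSet_subset {n : ℕ} (A : Set (Mon n)) (d : ℕ) : lexSet A d ⊆ A := fun _ h => h.1

theorem lexSet_zero {n : ℕ} (A : Set (Mon n)) : lexSet A 0 = ∅ := by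
  ext
  simp [lexSet]

theorem lexSet_of_ncard_le {n : ℕ} {A : Set (Mon n)} (hA : A.Finite) {d : ℕ} (h : A.ncard ≤ d) :
    lexSet A d = A := by
  refine (lexSet_subset A d).antisymm fun m hm => ⟨hm, lt_of_lt_of_le ?_ h⟩
  refine Set.ncard_lt_ncard ⟨fun v hv => hv.1, fun hsub => ?_⟩ hA
  exact lt_irrefl _ (hsub hm).2

theorem lexSet_image {n k : ℕ} {f : Mon n → Mon k}
    (hf : ∀ u v, toLex (f u) < toLex (f v) ↔ toLex u < toLex v) (A : Set (Mon n)) (d : ℕ) :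
    lexSet (f '' A) d = f '' lexSet A d := by
  have hinj : Function.Injective f := by
    intro u v huv
    rcases lt_trichotomy (toLex u) (toLex v) with h | h | h
    · exact absurd ((hf _ _).2 h) (by simp [huv])
    · exact toLex.injective h
    · exact absurd ((hf _ _).2 h) (by simp [huv])
  have hset : ∀ m, {v | v ∈ f '' A ∧ toLex (f m) < toLex v} =
      f '' {v | v ∈ A ∧ toLex m < toLex v} := by
    intro m
    ext w
    constructor
    · rintro ⟨⟨v, hv, rfl⟩, hlt⟩
      exact ⟨v, ⟨hv, (hf _ _).1 hlt⟩, rfl⟩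
    · rintro ⟨v, ⟨hv, hlt⟩, rfl⟩
      exact ⟨⟨v, hv, rfl⟩, (hf _ _).2 hlt⟩
  ext w
  constructor
  · rintro ⟨⟨m, hm, rfl⟩, hlt⟩
    rw [hset, Set.ncard_image_of_injective _ hinj] at hlt
    exact ⟨m, ⟨hm, hlt⟩, rfl⟩
  · rintro ⟨m, ⟨hm, hlt⟩, rfl⟩
    refine ⟨⟨m, hm, rfl⟩, ?_⟩
    rwa [hset, Set.ncard_image_of_injective _ hinj]

/-- The subtraction is truncated: `B` contributes nothing until `A` is exhausted. -/
theorem lexSet_union {n : ℕ} {A B : Set (Mon n)} (hA : A.Finite) (hB : B.Finite)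
    (hlt : ∀ u ∈ A, ∀ v ∈ B, toLex v < toLex u) (d : ℕ) :
    lexSet (A ∪ B) d = lexSet A d ∪ lexSet B (d - A.ncard) := by
  have hsetA : ∀ m ∈ A, {v | v ∈ A ∪ B ∧ toLex m < toLex v} = {v | v ∈ A ∧ toLex m < toLex v} := by
    intro m hm
    ext v
    constructor
    · rintro ⟨hv | hv, h⟩
      · exact ⟨hv, h⟩
      · exact absurd h (hlt m hm v hv).asymm
    · rintro ⟨hv, h⟩
      exact ⟨Or.inl hv, h⟩
  have hsetB : ∀ m ∈ B, {v | v ∈ A ∪ B ∧ toLex m < toLex v} =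
      A ∪ {v | v ∈ B ∧ toLex m < toLex v} := by
    intro m hm
    ext v
    constructor
    · rintro ⟨hv | hv, h⟩
      · exact Or.inl hv
      · exact Or.inr ⟨hv, h⟩
    · rintro (hv | ⟨hv, h⟩)
      · exact ⟨Or.inl hv, hlt v hv m hm⟩
      · exact ⟨Or.inr hv, h⟩
  have hcard : ∀ m, (A ∪ {v | v ∈ B ∧ toLex m < toLex v}).ncard =
      A.ncard + {v | v ∈ B ∧ toLex m < toLex v}.ncard := by
    intro m
    refine Set.ncard_union_eq ?_ hA (hB.subset fun _ h => h.1)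
    exact Set.disjoint_left.2 fun v hv hv' => lt_irrefl _ (hlt v hv v hv'.1)
  ext m
  constructor
  · rintro ⟨hm | hm, h⟩
    · rw [hsetA m hm] at h
      exact Or.inl ⟨hm, h⟩
    · rw [hsetB m hm, hcard] at h
      exact Or.inr ⟨hm, by omega⟩
  · rintro (⟨hm, h⟩ | ⟨hm, h⟩)
    · exact ⟨Or.inl hm, by rwa [hsetA m hm]⟩
    · exact ⟨Or.inr hm, by rw [hsetB m hm, hcard]; omega⟩

/-! ### Splitting off the first variable -/

/-- Multiplication by the first variable. -/
noncomputable def mulFirst {n : ℕ} (e : Mon (n + 1)) : Mon (n + 1) := Finsupp.single 0 1 + e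

/-- A monomial as a monomial that does not involve a new first variable. -/
noncomputable def addFirst {n : ℕ} (e : Mon n) : Mon (n + 1) := Finsupp.cons 0 e

theorem mulFirst_injective (n : ℕ) : Function.Injective (mulFirst (n := n)) :=
  add_right_injective _

theorem addFirst_injective (n : ℕ) : Function.Injective (addFirst (n := n)) :=
  Finsupp.cons_right_injective 0

@[simp] theorem mulFirst_zero {n : ℕ} (e : Mon (n + 1)) : mulFirst e 0 = e 0 + 1 := by
  simp [mulFirst, add_comm]

@[simp] theorem addFirst_zero {n : ℕ} (e : Mon n) : addFirst e 0 = 0 := by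
  simp [addFirst]

theorem degree_mulFirst {n : ℕ} (e : Mon (n + 1)) : (mulFirst e).degree = e.degree + 1 := by
  simp [mulFirst, add_comm]

theorem degree_addFirst {n : ℕ} (e : Mon n) : (addFirst e).degree = e.degree := by
  simp [addFirst, Finsupp.degree_eq_sum, Fin.sum_univ_succ]

theorem exists_mulFirst {n : ℕ} {e : Mon (n + 1)} (h : e 0 ≠ 0) : ∃ u, e = mulFirst u := by
  refine ⟨e - Finsupp.single 0 1, ?_⟩
  rw [mulFirst, add_tsub_cancel_of_le]
  simpa [Nat.one_le_iff_ne_zero] using h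

theorem exists_addFirst {n : ℕ} {e : Mon (n + 1)} (h : e 0 = 0) : ∃ u, e = addFirst u := by
  refine ⟨e.tail, ?_⟩
  rw [addFirst, ← h, Finsupp.cons_tail]

theorem toLex_mulFirst_lt {n : ℕ} (u v : Mon (n + 1)) :
    toLex (mulFirst u) < toLex (mulFirst v) ↔ toLex u < toLex v := by
  simp only [Finsupp.Lex.lt_iff, ofLex_toLex, mulFirst, Finsupp.add_apply, add_right_inj,
    add_lt_add_iff_left]

theorem toLex_addFirst_lt {n : ℕ} (u v : Mon n) :
    toLex (addFirst u) < toLex (addFirst v) ↔ toLex u < toLex v := by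
  simp [Finsupp.Lex.lt_iff, addFirst, Fin.exists_fin_succ, Fin.forall_fin_succ]

theorem toLex_addFirst_lt_mulFirst {n : ℕ} (u : Mon n) (v : Mon (n + 1)) :
    toLex (addFirst u) < toLex (mulFirst v) := by
  rw [Finsupp.Lex.lt_iff]
  exact ⟨0, fun j hj => absurd hj (Fin.not_lt_zero j), by simp⟩

theorem boundedMon_succ (n a t : ℕ) :
    boundedMon n (a + 1) (t + 1) = mulFirst '' boundedMon n a t ∪ addFirst '' monS n (t + 1) := by
  ext e
  constructor
  · rintro ⟨hd, he⟩
    by_cases h0 : e 0 = 0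
    · obtain ⟨u, rfl⟩ := exists_addFirst h0
      exact Or.inr ⟨u, by rwa [degree_addFirst] at hd, rfl⟩
    · obtain ⟨u, rfl⟩ := exists_mulFirst h0
      rw [degree_mulFirst] at hd
      rw [mulFirst_zero] at he
      exact Or.inl ⟨u, ⟨by omega, by omega⟩, rfl⟩
  · rintro (⟨u, ⟨hd, hu⟩, rfl⟩ | ⟨u, hd, rfl⟩)
    · exact ⟨by rw [degree_mulFirst, hd], by rw [mulFirst_zero]; omega⟩
    · exact ⟨by rw [degree_addFirst]; exact hd, by simp⟩

theorem disjoint_mulFirst_addFirst {n : ℕ} (A : Set (Mon (n + 1))) (B : Set (Mon n)) :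
    Disjoint (mulFirst '' A) (addFirst '' B) := by
  rw [Set.disjoint_left]
  rintro _ ⟨u, _, rfl⟩ ⟨v, _, h⟩
  simpa using DFunLike.congr_fun h 0

theorem ncard_mulFirst_union_addFirst {n : ℕ} {A : Set (Mon (n + 1))} {B : Set (Mon n)}
    (hA : A.Finite) (hB : B.Finite) :
    (mulFirst '' A ∪ addFirst '' B).ncard = A.ncard + B.ncard := by
  rw [Set.ncard_union_eq (disjoint_mulFirst_addFirst A B) (hA.image _) (hB.image _),
    Set.ncard_image_of_injective _ (mulFirst_injective n),
    Set.ncard_image_of_injective _ (addFirst_injective n)]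

theorem ncard_boundedMon_succ (n a t : ℕ) :
    (boundedMon n (a + 1) (t + 1)).ncard = (boundedMon n a t).ncard + (monS n (t + 1)).ncard := by
  rw [boundedMon_succ,
    ncard_mulFirst_union_addFirst (boundedMon_finite _ _ _) (monS_finite _ _)]

theorem lexSet_boundedMon_succ (n a t d : ℕ) :
    lexSet (boundedMon n (a + 1) (t + 1)) d = mulFirst '' lexSet (boundedMon n a t) d ∪
      addFirst '' lexSet (monS n (t + 1)) (d - (boundedMon n a t).ncard) := by
  rw [boundedMon_succ, lexSet_union ((boundedMon_finite _ _ _).image _)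
    ((monS_finite _ _).image _), lexSet_image toLex_mulFirst_lt, lexSet_image toLex_addFirst_lt,
    Set.ncard_image_of_injective _ (mulFirst_injective n)]
  rintro _ ⟨u, _, rfl⟩ _ ⟨v, _, rfl⟩
  exact toLex_addFirst_lt_mulFirst v u

theorem mulS_subset_monS {n t : ℕ} {M : Set (Mon n)} (h : M ⊆ monS n t) :
    mulS M ⊆ monS n (t + 1) := by
  rintro _ ⟨i, m, hm, rfl⟩
  have := h hm
  simp only [monS, Set.mem_ofPred_eq] at this
  simp [monS, this, add_comm]

theorem boundedMul_subset {n a t : ℕ} {M : Set (Mon (n + 1))} (h : M ⊆ boundedMon n a t) (b : ℕ) :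
    boundedMul b M ⊆ boundedMon n b (t + 1) :=
  fun _ he => ⟨mulS_subset_monS (fun _ hm => (h hm).1) he.1, he.2⟩

theorem boundedMul_boundedMon (n a t : ℕ) :
    boundedMul a (boundedMon n a t) = boundedMon n a (t + 1) := by
  refine (boundedMul_subset subset_rfl a).antisymm fun e he => ⟨?_, he.2⟩
  have hne : e ≠ 0 := by
    rintro rfl
    simpa using he.1
  obtain ⟨i, hi⟩ := Finsupp.ne_iff.1 hne
  have hle : Finsupp.single i 1 ≤ e := by
    simpa [Nat.one_le_iff_ne_zero] using hi
  obtain ⟨u, rfl⟩ := exists_add_of_le hle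
  refine ⟨i, u, ⟨?_, ?_⟩, rfl⟩
  · have := he.1
    rw [map_add, Finsupp.degree_single] at this
    omega
  · have := he.2
    rw [Finsupp.add_apply] at this
    omega

theorem mulFirst_mul {n : ℕ} (i : Fin (n + 1)) (m : Mon (n + 1)) :
    Finsupp.single i 1 + mulFirst m = mulFirst (Finsupp.single i 1 + m) :=
  add_left_comm _ _ _

theorem addFirst_mul {n : ℕ} (i : Fin n) (m : Mon n) :
    Finsupp.single i.succ 1 + addFirst m = addFirst (Finsupp.single i 1 + m) := by
  ext j
  refine Fin.cases ?_ (fun j => ?_) j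
  · simp [addFirst]
  · simp [addFirst, Finsupp.single_apply]

theorem boundedMul_mulFirst {n : ℕ} (a : ℕ) (M : Set (Mon (n + 1))) :
    boundedMul (a + 1) (mulFirst '' M) = mulFirst '' boundedMul a M := by
  ext e
  constructor
  · rintro ⟨⟨i, _, ⟨m, hm, rfl⟩, rfl⟩, he⟩
    rw [mulFirst_mul] at he ⊢
    rw [mulFirst_zero] at he
    exact ⟨_, ⟨⟨i, m, hm, rfl⟩, by omega⟩, rfl⟩
  · rintro ⟨_, ⟨⟨i, m, hm, rfl⟩, he⟩, rfl⟩
    refine ⟨⟨i, _, ⟨m, hm, rfl⟩, (mulFirst_mul i m).symm⟩, ?_⟩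
    rw [mulFirst_zero]
    omega

/-- Multiplying `M` by the first variable gives nothing new, since the multiples of that variable
are already all present. -/
theorem boundedMul_union {n : ℕ} (a t : ℕ) {M : Set (Mon n)} (hM : M ⊆ monS n (t + 1)) :
    boundedMul (a + 1) (mulFirst '' boundedMon n a t ∪ addFirst '' M) =
      mulFirst '' boundedMon n a (t + 1) ∪ addFirst '' mulS M := by
  have hfirst := boundedMul_mulFirst a (boundedMon n a t)
  rw [boundedMul_boundedMon] at hfirst
  ext e
  constructor
  · rintro ⟨⟨i, m, hm | hm, rfl⟩, he⟩
    · rw [← hfirst]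
      exact Or.inl ⟨⟨i, m, hm, rfl⟩, he⟩
    · obtain ⟨u, hu, rfl⟩ := hm
      refine Fin.cases (fun he => ?_) (fun i _ => ?_) i he
      · refine Or.inl ⟨addFirst u, ⟨?_, ?_⟩, rfl⟩
        · rw [degree_addFirst]
          exact hM hu
        · simpa using he
      · exact Or.inr ⟨_, ⟨i, u, hu, rfl⟩, (addFirst_mul i u).symm⟩
  · rintro (he | ⟨_, ⟨i, u, hu, rfl⟩, rfl⟩)
    · rw [← hfirst] at he
      obtain ⟨⟨i, m, hm, rfl⟩, he⟩ := he
      exact ⟨⟨i, m, Or.inl hm, rfl⟩, he⟩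
    · exact ⟨⟨i.succ, _, Or.inr ⟨u, hu, rfl⟩, (addFirst_mul i u).symm⟩, by simp⟩

/-! ### Recursions for the growth -/

/-- The number of multiples of the first `d` monomials of `boundedMon n a t`. -/
noncomputable def growth (n a t d : ℕ) : ℕ := (boundedMul a (lexSet (boundedMon n a t) d)).ncard

theorem growthR_eq (F : Type*) [Field F] (n a t d : ℕ) :
    growthR F (n + 1) a t d = growth n a t d := by
  rw [growthR, growth, monR_eq, mulR_eq]

theorem mulS_empty (n : ℕ) : mulS (∅ : Set (Mon n)) = ∅ := by
  ext
  simp [mulS]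

theorem growth_succ (n a t d : ℕ) :
    growth n (a + 1) (t + 1) d =
      growth n a t d + growthS n (t + 1) (d - (boundedMon n a t).ncard) := by
  rw [growth, growthS, lexSet_boundedMon_succ]
  rcases le_or_gt d (boundedMon n a t).ncard with h | h
  · rw [Nat.sub_eq_zero_of_le h, lexSet_zero, Set.image_empty, Set.union_empty,
      boundedMul_mulFirst, Set.ncard_image_of_injective _ (mulFirst_injective n), mulS_empty,
      Set.ncard_empty, growth, add_zero]
  · rw [growth, lexSet_of_ncard_le (boundedMon_finite _ _ _) h.le, boundedMul_boundedMon,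
      boundedMul_union a t (lexSet_subset _ _), ncard_mulFirst_union_addFirst
        (boundedMon_finite _ _ _)]
    exact (monS_finite n (t + 2)).subset (mulS_subset_monS (lexSet_subset _ _))

theorem growth_zero (n t d : ℕ) : growth n 0 t d = 0 := by
  simp [growth, boundedMul]

theorem boundedMon_zero (n t : ℕ) : boundedMon n 0 t = ∅ := by
  simp [boundedMon]

/-- A large `a` imposes no bound, so the recursions for `S` are instances of those for `R`. -/
theorem monS_eq {n a t : ℕ} (h : t < a) : monS (n + 1) t = boundedMon n a t := by
  ext e
  constructor
  · intro he
    refine ⟨he, lt_of_le_of_lt (Finsupp.le_degree 0 e) ?_⟩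
    rw [show e.degree = t from he]
    exact h
  · exact fun he => he.1

theorem growthS_eq {n a t : ℕ} (h : t + 1 < a) (d : ℕ) :
    growthS (n + 1) t d = growth n a t d := by
  rw [growthS, growth, ← monS_eq (by omega : t < a)]
  congr 1
  ext e
  refine ⟨fun he => ⟨he, ?_⟩, fun he => he.1⟩
  have := mulS_subset_monS (lexSet_subset _ _) he
  rw [monS_eq h] at this
  exact this.2

theorem boundedMon_degree_zero (n a : ℕ) : boundedMon n (a + 1) 0 = {0} := by
  ext e
  simp only [boundedMon, Set.mem_ofPred_eq, Finsupp.degree_eq_zero_iff, Set.mem_singleton_iff]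
  exact ⟨fun h => h.1, fun h => ⟨h, by simp [h]⟩⟩

theorem mulS_one (n : ℕ) : mulS {(0 : Mon n)} = Set.range fun i => Finsupp.single i 1 := by
  ext e
  simp [mulS, eq_comm]

theorem single_one_injective (n : ℕ) :
    Function.Injective fun i : Fin n => (Finsupp.single i 1 : Mon n) :=
  Finsupp.single_left_injective one_ne_zero

theorem growthS_degree_zero (n d : ℕ) (hd : 0 < d) : growthS (n + 1) 0 d = n + 1 := by
  rw [growthS, monS_eq (a := 0 + 1) one_pos, boundedMon_degree_zero, lexSet_of_ncard_le (Set.finite_singleton _)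
    (by rw [Set.ncard_singleton]; omega), mulS_one, ← Set.image_univ,
    Set.ncard_image_of_injective _ (single_one_injective _), Set.ncard_univ, Nat.card_fin]

theorem growth_one_degree_zero (n d : ℕ) (hd : 0 < d) : growth n 1 0 d = n := by
  have hset : boundedMul 1 {(0 : Mon (n + 1))} =
      (fun i => Finsupp.single i 1) '' Set.range (Fin.succ : Fin n → Fin (n + 1)) := by
    ext e
    rw [boundedMul, mulS_one]
    constructor
    · rintro ⟨⟨i, rfl⟩, he⟩
      refine ⟨i, ?_, rfl⟩
      rw [Fin.range_succ]
      rintro rfl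
      simp at he
    · rintro ⟨_, ⟨i, rfl⟩, rfl⟩
      exact ⟨⟨_, rfl⟩, by simp⟩
  rw [growth, boundedMon_degree_zero, lexSet_of_ncard_le (Set.finite_singleton _)
    (by rw [Set.ncard_singleton]; omega), hset,
    Set.ncard_image_of_injective _ (single_one_injective _), ← Set.image_univ,
    Set.ncard_image_of_injective _ (Fin.succ_injective n), Set.ncard_univ, Nat.card_fin]

theorem growthS_zero (n t : ℕ) : growthS n t 0 = 0 := by
  rw [growthS, lexSet_zero, mulS_empty, Set.ncard_empty]

theorem ncard_monS_succ (n t : ℕ) :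
    (monS (n + 1) (t + 1)).ncard = (monS (n + 1) t).ncard + (monS n (t + 1)).ncard := by
  rw [monS_eq (Nat.lt_succ_self (t + 1)), ncard_boundedMon_succ, monS_eq (Nat.lt_succ_self t)]

theorem growthS_succ (n t d : ℕ) :
    growthS (n + 1) (t + 1) d =
      growthS (n + 1) t d + growthS n (t + 1) (d - (monS (n + 1) t).ncard) := by
  rw [growthS_eq (Nat.lt_succ_self (t + 2)), growth_succ, growthS_eq (Nat.lt_succ_self (t + 1)),
    monS_eq (by omega : t < t + 2)]

theorem monS_no_variables (t : ℕ) : monS 0 (t + 1) = ∅ := by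
  ext e
  simp [monS, Subsingleton.elim e 0]

theorem growthS_no_variables (t d : ℕ) : growthS 0 (t + 1) d = 0 := by
  rw [growthS, Set.subset_empty_iff.1 ((lexSet_subset (monS 0 (t + 1)) d).trans
    (monS_no_variables t).subset), mulS_empty, Set.ncard_empty]

/-- For `t < a` only the power `x_1 ^ a` can vanish. -/
theorem growth_add_eq_growthS {n a t d : ℕ} (hd : 0 < d) (h : t < a) :
    growth n a t d + (if t + 1 = a then 1 else 0) = growthS (n + 1) t d := by
  induction t generalizing a with
  | zero =>
    obtain ⟨a, rfl⟩ : ∃ b, a = b + 1 := ⟨a - 1, by omega⟩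
    rcases Nat.eq_zero_or_pos a with rfl | ha
    · simp [growth_one_degree_zero n d hd, growthS_degree_zero n d hd]
    · rw [if_neg (by omega), add_zero, growthS_eq (by omega : 0 + 1 < a + 1)]
  | succ t ih =>
    obtain ⟨a, rfl⟩ : ∃ b, a = b + 1 := ⟨a - 1, by omega⟩
    rw [growth_succ, growthS_succ, ← ih (by omega : t < a), monS_eq (by omega : t < a)]
    simp only [add_left_inj]
    omega

/-! ### Growth as an initial sum -/

theorem ncard_monS_and_growthS_eq_weights (m s : ℕ) :
    (monS (m + 1) s).ncard = (weights m s).length ∧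
      ∀ d, growthS (m + 1) s d = prefixSum (weights m s) d := by
  induction m generalizing s with
  | zero => induction s with
    | zero =>
      refine ⟨by rw [monS_eq (a := 0 + 1) one_pos, boundedMon_degree_zero]; simp [weights], ?_⟩
      rintro (_ | d)
      · rw [growthS_zero, prefixSum_zero]
      · rw [growthS_degree_zero _ _ d.succ_pos]
        simp [weights, prefixSum]
    | succ s ih =>
      refine ⟨?_, fun d => ?_⟩
      · rw [ncard_monS_succ, ih.1, monS_no_variables, Set.ncard_empty, add_zero, weights, weights]
      · rw [growthS_succ, ih.2, growthS_no_variables, add_zero, weights, weights]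
  | succ m ihm => induction s with
    | zero =>
      refine ⟨by rw [monS_eq (a := 0 + 1) one_pos, boundedMon_degree_zero]; simp [weights], ?_⟩
      rintro (_ | d)
      · rw [growthS_zero, prefixSum_zero]
      · rw [growthS_degree_zero _ _ d.succ_pos]
        simp [weights, prefixSum]
    | succ s ih =>
      refine ⟨?_, fun d => ?_⟩
      · rw [ncard_monS_succ, ih.1, (ihm (s + 1)).1, weights, List.length_append]
      · rw [growthS_succ, ih.1, ih.2, (ihm (s + 1)).2, weights, prefixSum_append]

theorem ncard_monS_eq (m s : ℕ) : (monS (m + 1) s).ncard = (weights m s).length :=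
  (ncard_monS_and_growthS_eq_weights m s).1

theorem growthS_eq_weights (m s d : ℕ) : growthS (m + 1) s d = prefixSum (weights m s) d :=
  (ncard_monS_and_growthS_eq_weights m s).2 d

theorem ncard_boundedMon_add (m a p : ℕ) :
    (boundedMon (m + 1) a (p + a)).ncard = (blocks m (p + 1) a).length := by
  induction a with
  | zero => rw [boundedMon_zero, Set.ncard_empty]; rfl
  | succ a ih =>
    rw [← add_assoc, ncard_boundedMon_succ, ih, ncard_monS_eq, blocks, List.length_append,
      show p + 1 + a = p + a + 1 by omega]

theorem growth_add (m a p d : ℕ) :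
    growth (m + 1) a (p + a) d = prefixSum (blocks m (p + 1) a) d := by
  induction a with
  | zero => rw [growth_zero]; simp [blocks, prefixSum]
  | succ a ih =>
    rw [← add_assoc, growth_succ, ih, ncard_boundedMon_add, growthS_eq_weights, blocks,
      prefixSum_append, show p + 1 + a = p + a + 1 by omega]

theorem boundedMon_no_variables {a t : ℕ} (h : a ≤ t) : boundedMon 0 a t = ∅ := by
  refine Set.eq_empty_of_forall_notMem fun e he => ?_
  have h1 : e.degree = t := he.1
  have h2 : e 0 < a := he.2
  rw [Finsupp.degree_eq_sum, Fin.sum_univ_succ, Fin.sum_univ_zero, add_zero] at h1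
  omega

/-! ### The three claims -/

theorem growth_lt_growth_succ {n a t d : ℕ} (hd : 0 < d) (ht : 0 < t)
    (h : d ≤ (boundedMon n a t).ncard) :
    d ≤ (boundedMon (n + 1) a t).ncard ∧ growth n a t d < growth (n + 1) a t d := by
  rcases lt_or_ge t a with hta | hta
  · rw [← monS_eq hta, ncard_monS_eq] at *
    refine ⟨h.trans (length_weights_le_succ n t), ?_⟩
    have h1 := growth_add_eq_growthS (n := n) hd hta
    have h2 := growth_add_eq_growthS (n := n + 1) hd hta
    have h3 := prefixSum_weights_lt_succ ht hd h
    rw [growthS_eq_weights] at h1 h2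
    omega
  · obtain ⟨p, rfl⟩ := Nat.exists_eq_add_of_le' hta
    cases n with
    | zero =>
      rw [boundedMon_no_variables hta, Set.ncard_empty] at h
      omega
    | succ m =>
      rw [ncard_boundedMon_add] at *
      rw [growth_add, growth_add]
      exact ⟨h.trans (length_blocks_le_succ _ _ _), prefixSum_blocks_lt_succ hd h⟩

theorem growth_succ_degree_le {n a t d : ℕ} (hd : 0 < d) (h : d ≤ (boundedMon n a t).ncard)
    (h' : d ≤ (boundedMon n a (t + 1)).ncard) : growth n a (t + 1) d ≤ growth n a t d := by
  rcases lt_or_ge t a with hta | hta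
  · have h1 := growth_add_eq_growthS (n := n) hd hta
    rw [growthS_eq_weights] at h1
    rw [← monS_eq hta, ncard_monS_eq] at h
    have h3 := prefixSum_of_prefix (weights_prefix n t.le_succ) h
    rcases (show t + 1 ≤ a from hta).lt_or_eq with hlt | rfl
    · have h2 := growth_add_eq_growthS (n := n) hd hlt
      rw [growthS_eq_weights] at h2
      rw [if_neg hlt.ne] at h1
      simp only [Nat.succ_eq_add_one] at h3
      omega
    · cases n with
      | zero =>
        rw [boundedMon_no_variables le_rfl, Set.ncard_empty] at h'
        omega
      | succ m =>
        have h2 := growth_add m (t + 1) 0 d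
        have h4 := ncard_boundedMon_add m (t + 1) 0
        rw [zero_add, zero_add] at h2 h4
        -- At `t + 1 = a` the growth in degree `t` has lost `x_1 ^ a`; strictness here makes up for
        -- that unit.
        have h5 := prefixSum_blocks_one_lt hd (h4 ▸ h')
        simp only [Nat.succ_eq_add_one] at h3
        rw [if_pos rfl] at h1
        omega
  · obtain ⟨p, rfl⟩ := Nat.exists_eq_add_of_le' hta
    cases n with
    | zero =>
      rw [boundedMon_no_variables hta, Set.ncard_empty] at h
      omega
    | succ m =>
      rw [show p + a + 1 = p + 1 + a by omega] at *
      rw [ncard_boundedMon_add] at h h'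
      rw [growth_add, growth_add]
      exact prefixSum_blocks_succ_le h h'

theorem growth_eq_growthS_of_large {m a d : ℕ} (ha : 0 < a) {t : ℕ} (ht : d + a ≤ t) :
    d ≤ (boundedMon (m + 2) a t).ncard ∧
      ∀ s, d ≤ (monS (m + 2) s).ncard → growth (m + 2) a t d = growthS (m + 2) s d := by
  obtain ⟨p, rfl⟩ := Nat.exists_eq_add_of_le' (show a ≤ t by omega)
  obtain ⟨b, rfl⟩ : ∃ b, a = b + 1 := ⟨a - 1, by omega⟩
  -- Since `p ≥ d`, the first block alone contains the first `d` entries.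
  have hlen : d ≤ (weights (m + 1) (p + 1)).length := by
    have := lt_length_weights m (p + 1)
    omega
  rw [ncard_boundedMon_add, growth_add, blocks_succ', List.length_append,
    prefixSum_append_left _ hlen]
  refine ⟨by omega, fun s hs => ?_⟩
  rw [ncard_monS_eq] at hs
  rw [growthS_eq_weights]
  rcases le_total s (p + 1) with h | h
  · exact prefixSum_of_prefix (weights_prefix _ h) hs
  · exact (prefixSum_of_prefix (weights_prefix _ h) hlen).symm

theorem mainTheorem3 (F : Type*) [Field F] (n a d : ℕ) (hn : 0 < n) (ha : 0 < a) (hd : 0 < d) :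
    (∀ t : ℕ, 0 < t → d ≤ (monR F n a t).ncard →
      d ≤ (monR F (n + 1) a t).ncard ∧ growthR F n a t d < growthR F (n + 1) a t d) ∧
    (∀ t : ℕ, 0 < t → d ≤ (monR F n a t).ncard → d ≤ (monR F n a (t + 1)).ncard →
      growthR F n a (t + 1) d ≤ growthR F n a t d) ∧
    (3 ≤ n → ∃ T : ℕ, ∀ t' : ℕ, T ≤ t' →
      d ≤ (monR F n a t').ncard ∧
      ∀ s : ℕ, d ≤ (monS (n - 1) s).ncard → growthR F n a t' d = growthS (n - 1) s d) := by
  obtain ⟨n, rfl⟩ : ∃ k, n = k + 1 := ⟨n - 1, by omega⟩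
  simp only [monR_eq, growthR_eq, Nat.add_sub_cancel]
  refine ⟨fun t ht h => growth_lt_growth_succ hd ht h,
    fun t _ h h' => growth_succ_degree_le hd h h', fun h3 => ⟨d + a, fun t ht => ?_⟩⟩
  obtain ⟨m, rfl⟩ : ∃ k, n = k + 2 := ⟨n - 2, by omega⟩
  exact growth_eq_growthS_of_large ha ht
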